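/- For $n,k\ge 1$ let $a_{n,k}(213)$ be the number of permutations $\pi$ of $[n]=\{1,\dots,n\}$ such that $\pi$ consists of a single $n$-cycle, the one-line notation $\pi(1)\pi(2)\cdots\pi(n)$ avoids the pattern $\delta_k=k(k-1)\cdots 21$, and the cycle form $C(\pi)=(c_1,c_2,\dots,c_n)$, where $c_1=1$ and $c_{i+1}=\pi(c_i)$ for $1\le i<n$, avoids the pattern $213$ as a word $c_1c_2\cdots c_n$. (A word avoids a pattern if no subsequence of it is in the same relative order as the pattern.) Then for all $n\ge 2$ and $k\ge 4$, $$a_{n,k}(213)=\sum_{i=1}^{n-1}a_{i,k}(213)\,a_{n-i,k-1}(213),$$ with base cases - $a_{1,1}(213)=0$ and $a_{1,k}(213)=1$ for $k\ge 2$; - $a_{n,1}(213)=a_{n,2}(213)=0$ for $n\ge 2$; - $a_{n,3}(213)=2^{n-2}$ for $n\ge 2$. -/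

import Mathlib

namespace CyclePattern

/-- The word `w` contains the pattern `σ`: some subsequence `w (f 0), …, w (f (k - 1))`, taken at
increasing positions, is in the same relative order as `σ 0, …, σ (k - 1)`. Permutations and words
are indexed by `Fin n = {0, …, n - 1}` in place of `[n] = {1, …, n}`. -/
def Contains {n k : ℕ} (w : Fin n → Fin n) (σ : Equiv.Perm (Fin k)) : Prop :=
  ∃ f : Fin k → Fin n, StrictMono f ∧ ∀ i j, w (f i) < w (f j) ↔ σ i < σ j

/-- The word `w` avoids the pattern `σ`. -/
def Avoids {n k : ℕ} (w : Fin n → Fin n) (σ : Equiv.Perm (Fin k)) : Prop :=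
  ¬ Contains w σ

/-- `π` is composed of a single `n`-cycle, with `n ≥ 1`. (For `n = 1` this is the identity, which
is not an `Equiv.Perm.IsCycle`, hence the use of `IsCycleOn`.) -/
def IsCyclicPerm {n : ℕ} (π : Equiv.Perm (Fin n)) : Prop :=
  0 < n ∧ π.IsCycleOn Set.univ

/-- The cycle form `C(π) = (c₁, c₂, …, cₙ)` of a cyclic permutation, starting with the least
element, with `cᵢ₊₁ = π cᵢ`. -/
def cycleForm {n : ℕ} (π : Equiv.Perm (Fin n)) : Fin n → Fin n :=
  fun i => (π ^ (i : ℕ)) ⟨0, i.pos⟩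

/-- The set of cyclic permutations of `[n]` whose one-line notation avoids `σ` and whose cycle
form avoids `τ`. -/
def avoidanceClass (n : ℕ) {k m : ℕ} (σ : Equiv.Perm (Fin k)) (τ : Equiv.Perm (Fin m)) :
    Set (Equiv.Perm (Fin n)) :=
  {π | IsCyclicPerm π ∧ Avoids (fun i => π i) σ ∧ Avoids (cycleForm π) τ}

/-- The decreasing pattern `δ_k = k (k - 1) … 2 1`. -/
def decreasing (k : ℕ) : Equiv.Perm (Fin k) := Fin.revPerm

/-- The pattern `213`. -/
def pattern213 : Equiv.Perm (Fin 3) := Equiv.swap 0 1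

/-- The number `a_{n,k}(τ)` of cyclic permutations of `[n]` that avoid `δ_k` in one-line notation
and whose cycle form avoids `τ`. -/
noncomputable def a (n k : ℕ) {m : ℕ} (τ : Equiv.Perm (Fin m)) : ℕ :=
  (avoidanceClass n (decreasing k) τ).ncard

end CyclePattern

namespace CyclePattern

/-- The size of a longest decreasing chain among the points of `treePoints` other than the lowest
one, computed recursively. -/
def lowHeight : BinaryTree Unit → ℕ
  | .nil => 0
  | .node _ .nil B => max 1 (lowHeight B)
  | .node _ A B => max (lowHeight A) (2 + lowHeight B)

/-- The size of a longest decreasing chain among the points of `treePoints`. -/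
def height : BinaryTree Unit → ℕ
  | .nil => 1
  | t => max 2 (lowHeight t)

/-- The steps of the path that starts at `z`, runs through `treeWord t a` and ends at `e`. -/
def treePoints : BinaryTree Unit → ℕ → ℕ → ℕ → Finset (ℕ × ℕ)
  | .nil, _, z, e => {(z, e)}
  | .node _ A B, a, z, e =>
    treePoints A (a + 1 + B.numNodes) z a ∪ treePoints B (a + 1) a e

/-- Any two points of `D` are in decreasing position. -/
def IsDecreasing (D : Finset (ℕ × ℕ)) : Prop :=
  ∀ p ∈ D, ∀ q ∈ D, p ≠ q → (p.1 < q.1 ∧ q.2 < p.2) ∨ (q.1 < p.1 ∧ p.2 < q.2)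

theorem IsDecreasing.mono {D E : Finset (ℕ × ℕ)} (hE : IsDecreasing E) (h : D ⊆ E) :
    IsDecreasing D :=
  fun p hp q hq => hE p (h hp) q (h hq)

theorem lowHeight_node_nil (u : Unit) (B : BinaryTree Unit) :
    lowHeight (.node u .nil B) = max 1 (lowHeight B) := by
  rw [lowHeight]

theorem lowHeight_node {A : BinaryTree Unit} (hA : A ≠ .nil) (u : Unit) (B : BinaryTree Unit) :
    lowHeight (.node u A B) = max (lowHeight A) (2 + lowHeight B) := by
  cases A with
  | nil => exact absurd rfl hA
  | node => rw [lowHeight]; simp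

theorem height_of_ne_nil {t : BinaryTree Unit} (h : t ≠ .nil) : height t = max 2 (lowHeight t) := by
  cases t with
  | nil => exact absurd rfl h
  | node => rw [height]; simp

theorem lowHeight_pos {t : BinaryTree Unit} (h : t ≠ .nil) : 1 ≤ lowHeight t := by
  cases t with
  | nil => exact absurd rfl h
  | node u A B =>
    by_cases hA : A = .nil
    · subst hA; rw [lowHeight_node_nil]; exact le_max_left _ _
    · rw [lowHeight_node hA]; omega

theorem height_le_lowHeight_add_one (t : BinaryTree Unit) : height t ≤ lowHeight t + 1 := by
  by_cases h : t = .nil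
  · subst h; simp [height]
  · have := lowHeight_pos h
    rw [height_of_ne_nil h]; omega

theorem height_le_max (t : BinaryTree Unit) : height t ≤ max 2 (lowHeight t) := by
  by_cases h : t = .nil
  · subst h; simp [height]
  · rw [height_of_ne_nil h]

theorem height_le_iff_lowHeight_le {h : ℕ} (hh : 2 ≤ h) (t : BinaryTree Unit) :
    height t ≤ h ↔ lowHeight t ≤ h := by
  by_cases ht : t = .nil
  · subst ht; simp [height, lowHeight]; omega
  · rw [height_of_ne_nil ht]; omega

theorem mem_treePoints_bounds (t : BinaryTree Unit) (a z e : ℕ) {p : ℕ × ℕ}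
    (hp : p ∈ treePoints t a z e) :
    (p.1 = z ∨ (a ≤ p.1 ∧ p.1 < a + t.numNodes)) ∧
      (p.2 = e ∨ (a ≤ p.2 ∧ p.2 < a + t.numNodes)) := by
  induction t generalizing a z e with
  | nil => simp [treePoints] at hp; simp [hp]
  | node u A B ihA ihB =>
    simp only [treePoints, Finset.mem_union] at hp
    simp only [BinaryTree.numNodes]
    rcases hp with hp | hp
    · have := ihA _ _ _ hp
      omega
    · have := ihB _ _ _ hp
      omega

theorem exists_mem_treePoints_fst (t : BinaryTree Unit) (a z e : ℕ) :
    ∃ y, (z, y) ∈ treePoints t a z e := by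
  induction t generalizing a z e with
  | nil => exact ⟨e, by simp [treePoints]⟩
  | node u A B ihA _ =>
    obtain ⟨y, hy⟩ := ihA (a + 1 + B.numNodes) z a
    exact ⟨y, by simp [treePoints, hy]⟩

theorem exists_mem_treePoints_snd (t : BinaryTree Unit) (a z e : ℕ) :
    ∃ x, (x, e) ∈ treePoints t a z e := by
  induction t generalizing a z e with
  | nil => exact ⟨z, by simp [treePoints]⟩
  | node u A B _ ihB =>
    obtain ⟨x, hx⟩ := ihB (a + 1) a e
    exact ⟨x, by simp [treePoints, hx]⟩

theorem corner_notMem_treePoints {t : BinaryTree Unit} (ht : t ≠ .nil) {a z e : ℕ} (hz : z < a)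
    (he : e < a) : (z, e) ∉ treePoints t a z e := by
  cases t with
  | nil => exact absurd rfl ht
  | node u A B =>
    simp only [treePoints, Finset.mem_union]
    rintro (h | h)
    · have := (mem_treePoints_bounds _ _ _ _ h).2
      simp only at this; omega
    · have := (mem_treePoints_bounds _ _ _ _ h).1
      simp only at this; omega

/-- A decreasing set has at most one point on each horizontal line. -/
theorem IsDecreasing.card_le_one_of_snd {D : Finset (ℕ × ℕ)} (hD : IsDecreasing D) {e : ℕ}
    (h : ∀ p ∈ D, p.2 = e) : D.card ≤ 1 := by
  rw [Finset.card_le_one]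
  intro p hp q hq
  by_contra hne
  have := hD p hp q hq hne
  have := h p hp
  have := h q hq
  omega

/-- A decreasing set has at most one point on each vertical line. -/
theorem IsDecreasing.card_le_one_of_fst {D : Finset (ℕ × ℕ)} (hD : IsDecreasing D) {z : ℕ}
    (h : ∀ p ∈ D, p.1 = z) : D.card ≤ 1 := by
  rw [Finset.card_le_one]
  intro p hp q hq
  by_contra hne
  have := hD p hp q hq hne
  have := h p hp
  have := h q hq
  omega

theorem card_le_of_isDecreasing (t : BinaryTree Unit) {a z e : ℕ} (hz : z < a) (he : e < a)
    {D : Finset (ℕ × ℕ)} (hD : IsDecreasing D) (hsub : D ⊆ treePoints t a z e) :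
    D.card ≤ height t ∧ ((∀ p ∈ D, p.2 ≠ e) → D.card ≤ lowHeight t) := by
  induction t generalizing a z e D with
  | nil =>
    simp only [treePoints] at hsub
    refine ⟨(Finset.card_le_card hsub).trans (by simp [height]), fun h => ?_⟩
    have : D = ∅ := by
      rw [Finset.eq_empty_iff_forall_notMem]
      intro p hp
      have h1 := hsub hp
      rw [Finset.mem_singleton] at h1
      exact h p hp (by rw [h1])
    simp [this]
  | node u A B ihA ihB =>
    simp only [treePoints] at hsub
    set DA := D.filter (· ∈ treePoints A (a + 1 + B.numNodes) z a) with hDA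
    set DB := D.filter (· ∉ treePoints A (a + 1 + B.numNodes) z a) with hDB
    have hcard : DA.card + DB.card = D.card := Finset.card_filter_add_card_filter_not _
    have hDAD : DA ⊆ D := Finset.filter_subset _ _
    have hDBD : DB ⊆ D := Finset.filter_subset _ _
    have hA : DA ⊆ treePoints A (a + 1 + B.numNodes) z a := fun p hp =>
      (Finset.mem_filter.1 hp).2
    have hB : DB ⊆ treePoints B (a + 1) a e := fun p hp => by
      have := Finset.mem_filter.1 hp
      exact (Finset.mem_union.1 (hsub this.1)).resolve_left this.2
    have hbA : ∀ p ∈ DA, _ := fun p hp => mem_treePoints_bounds _ _ _ _ (hA hp)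
    have hbB : ∀ p ∈ DB, _ := fun p hp => mem_treePoints_bounds _ _ _ _ (hB hp)
    have hcross : ∀ p ∈ DA, ∀ q ∈ DB,
        (p.1 < q.1 ∧ q.2 < p.2) ∨ (q.1 < p.1 ∧ p.2 < q.2) := fun p hp q hq =>
      hD p (hDAD hp) q (hDBD hq) fun h => (Finset.mem_filter.1 hq).2 (h ▸ hA hp)
    obtain ⟨ihA1, ihA2⟩ := ihA (by omega) (by omega) (hD.mono hDAD) hA
    obtain ⟨ihB1, ihB2⟩ := ihB (by omega) (by omega) (hD.mono hDBD) hB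
    rw [height_of_ne_nil (by simp)]
    have hhB := height_le_max B
    by_cases hAn : A = .nil
    · subst hAn
      rw [lowHeight_node_nil]
      simp only [treePoints] at hA
      have hA1 : DA.card ≤ 1 := (Finset.card_le_card hA).trans (by simp)
      rcases DA.eq_empty_or_nonempty with h0 | ⟨p, hp⟩
      · rw [h0, Finset.card_empty] at hcard
        refine ⟨by omega, fun h => ?_⟩
        have := ihB2 fun p hp => h p (hDBD hp)
        omega
      · have hp' := Finset.mem_singleton.1 (hA hp)
        have hBe : ∀ q ∈ DB, q.2 = e := fun q hq => by
          have h1 := hcross p hp q hq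
          have h2 := hbB q hq
          rw [hp'] at h1
          simp only at h1
          omega
        have hB1 := (hD.mono hDBD).card_le_one_of_snd hBe
        refine ⟨by omega, fun h => ?_⟩
        have : DB = ∅ := by
          rw [Finset.eq_empty_iff_forall_notMem]
          exact fun q hq => h q (hDBD hq) (hBe q hq)
        rw [this, Finset.card_empty] at hcard
        omega
    · rw [lowHeight_node hAn]
      suffices h : D.card ≤ max (lowHeight A) (2 + lowHeight B) from ⟨by omega, fun _ => h⟩
      rw [height_of_ne_nil hAn] at ihA1
      rcases DB.eq_empty_or_nonempty with h0 | ⟨q, hq⟩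
      · rw [h0, Finset.card_empty] at hcard
        omega
      · have hsplit : ∀ p ∈ DA, p.1 = z ∨ p.2 = a := fun p hp => by
          have h1 := hcross p hp q hq
          have h2 := hbB q hq
          have h3 := hbA p hp
          omega
        set Dl := DA.filter (·.2 = a) with hDl
        set Dz := DA.filter (¬ ·.2 = a) with hDz
        have hc : Dl.card + Dz.card = DA.card := Finset.card_filter_add_card_filter_not _
        have hl1 : Dl.card ≤ 1 := (hD.mono ((Finset.filter_subset _ _).trans hDAD)).card_le_one_of_snd
          fun p hp => (Finset.mem_filter.1 hp).2
        have hz1 : Dz.card ≤ 1 := (hD.mono ((Finset.filter_subset _ _).trans hDAD)).card_le_one_of_fst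
          fun p hp => (hsplit p (Finset.mem_filter.1 hp).1).resolve_right (Finset.mem_filter.1 hp).2
        rcases Dl.eq_empty_or_nonempty with h0 | ⟨p, hp⟩
        · rw [h0, Finset.card_empty] at hc
          have := height_le_lowHeight_add_one B
          omega
        · have hpA := (Finset.mem_filter.1 hp).1
          have hpa : p.2 = a := (Finset.mem_filter.1 hp).2
          have hpz : p.1 ≠ z := fun h => by
            have h1 := hA hpA
            rw [← Prod.mk.eta (p := p), h, hpa] at h1
            exact corner_notMem_treePoints hAn (by omega) (by omega) h1
          have := ihB2 fun r hr he' => by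
            have h1 := hcross p hpA r hr
            have h2 := hbB r hr
            have h3 := hbA p hpA
            omega
          omega

theorem IsDecreasing.insert {D : Finset (ℕ × ℕ)} (hD : IsDecreasing D) {p : ℕ × ℕ}
    (h : ∀ q ∈ D, (p.1 < q.1 ∧ q.2 < p.2) ∨ (q.1 < p.1 ∧ p.2 < q.2)) :
    IsDecreasing (insert p D) ∧ (insert p D).card = D.card + 1 := by
  refine ⟨fun q hq r hr hne => ?_, Finset.card_insert_of_notMem fun hp => ?_⟩
  · rw [Finset.mem_insert] at hq hr
    rcases hq with rfl | hq <;> rcases hr with rfl | hr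
    · exact absurd rfl hne
    · exact h r hr
    · exact (h q hq).symm
    · exact hD q hq r hr hne
  · have := h p hp
    omega

theorem isDecreasing_singleton (p : ℕ × ℕ) : IsDecreasing {p} := by
  intro q hq r hr hne
  rw [Finset.mem_singleton] at hq hr
  exact absurd (hq.trans hr.symm) hne

theorem exists_isDecreasing_card_eq_lowHeight (t : BinaryTree Unit) {a z e : ℕ} (hz : z < a)
    (he : e < a) :
    ∃ D ⊆ treePoints t a z e, IsDecreasing D ∧ (∀ p ∈ D, p.2 ≠ e) ∧ D.card = lowHeight t := by
  induction t generalizing a z e with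
  | nil => exact ⟨∅, by simp, by simp [IsDecreasing], by simp, by simp [lowHeight]⟩
  | node u A B ihA ihB =>
    obtain ⟨DA, hA1, hA2, hA3, hA4⟩ :=
      ihA (a := a + 1 + B.numNodes) (z := z) (e := a) (by omega) (by omega)
    obtain ⟨DB, hB1, hB2, hB3, hB4⟩ := ihB (a := a + 1) (z := a) (e := e) (by omega) (by omega)
    have hbA : ∀ p ∈ DA, _ := fun p hp => mem_treePoints_bounds _ _ _ _ (hA1 hp)
    have hbB : ∀ p ∈ DB, _ := fun p hp => mem_treePoints_bounds _ _ _ _ (hB1 hp)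
    simp only [treePoints]
    have hBcase : lowHeight (.node u A B) = lowHeight B → ∃ D ⊆
        treePoints A (a + 1 + B.numNodes) z a ∪ treePoints B (a + 1) a e,
        IsDecreasing D ∧ (∀ p ∈ D, p.2 ≠ e) ∧ D.card = lowHeight (.node u A B) := fun h =>
      ⟨DB, hB1.trans Finset.subset_union_right, hB2, hB3, by rw [h, hB4]⟩
    by_cases hAn : A = .nil
    · subst hAn
      rw [lowHeight_node_nil] at hBcase ⊢
      rcases le_total 1 (lowHeight B) with h | h
      · exact hBcase (max_eq_right h)
      · refine ⟨{(z, a)}, ?_, isDecreasing_singleton _, ?_, ?_⟩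
        · simp [treePoints]
        · simp; omega
        · simp [h]
    · rw [lowHeight_node hAn]
      rcases le_total (2 + lowHeight B) (lowHeight A) with h | h
      · refine ⟨DA, hA1.trans Finset.subset_union_left, hA2, fun p hp => ?_, ?_⟩
        · have := hbA p hp
          omega
        · rw [max_eq_left h, hA4]
      · obtain ⟨y, hy⟩ := exists_mem_treePoints_fst A (a + 1 + B.numNodes) z a
        obtain ⟨x, hx⟩ := exists_mem_treePoints_snd A (a + 1 + B.numNodes) z a
        have hya : y ≠ a := fun h =>
          corner_notMem_treePoints hAn (by omega) (by omega) (h ▸ hy)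
        have hxz : x ≠ z := fun h =>
          corner_notMem_treePoints hAn (by omega) (by omega) (h ▸ hx)
        have hyb := mem_treePoints_bounds _ _ _ _ hy
        have hxb := mem_treePoints_bounds _ _ _ _ hx
        simp only at hyb hxb
        obtain ⟨h1, h1'⟩ := hB2.insert (p := (x, a)) fun q hq => by
          have := hbB q hq
          have := hB3 q hq
          simp only
          omega
        obtain ⟨h2, h2'⟩ := h1.insert (p := (z, y)) fun q hq => by
          rw [Finset.mem_insert] at hq
          rcases hq with rfl | hq
          · simp only
            omega
          · have := hbB q hq
            have := hB3 q hq
            simp only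
            omega
        refine ⟨_, ?_, h2, ?_, ?_⟩
        · intro q hq
          simp only [Finset.mem_insert] at hq
          rcases hq with rfl | rfl | hq
          · exact Finset.mem_union_left _ hy
          · exact Finset.mem_union_left _ hx
          · exact Finset.mem_union_right _ (hB1 hq)
        · intro q hq
          simp only [Finset.mem_insert] at hq
          rcases hq with rfl | rfl | hq
          · simp only; omega
          · simp only; omega
          · exact hB3 q hq
        · rw [h2', h1', hB4, max_eq_right h]; omega

theorem exists_isDecreasing_card_eq_height (t : BinaryTree Unit) {a z e : ℕ} (hz : z < a)
    (he : e < a) : ∃ D ⊆ treePoints t a z e, IsDecreasing D ∧ D.card = height t := by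
  by_cases ht : t = .nil
  · subst ht
    exact ⟨{(z, e)}, by simp [treePoints], isDecreasing_singleton _, by simp [height]⟩
  · rw [height_of_ne_nil ht]
    rcases le_total 2 (lowHeight t) with h | h
    · obtain ⟨D, h1, h2, _, h4⟩ := exists_isDecreasing_card_eq_lowHeight t hz he
      exact ⟨D, h1, h2, by rw [h4, max_eq_right h]⟩
    · obtain ⟨y, hy⟩ := exists_mem_treePoints_fst t a z e
      obtain ⟨x, hx⟩ := exists_mem_treePoints_snd t a z e
      have hye : y ≠ e := fun h => corner_notMem_treePoints ht hz he (h ▸ hy)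
      have hxz : x ≠ z := fun h => corner_notMem_treePoints ht hz he (h ▸ hx)
      have hyb := mem_treePoints_bounds _ _ _ _ hy
      have hxb := mem_treePoints_bounds _ _ _ _ hx
      simp only at hyb hxb
      obtain ⟨h1, h1'⟩ := (isDecreasing_singleton (x, e)).insert (p := (z, y)) fun q hq => by
        rw [Finset.mem_singleton] at hq
        subst hq
        simp only
        omega
      refine ⟨_, ?_, h1, ?_⟩
      · intro q hq
        simp only [Finset.mem_insert, Finset.mem_singleton] at hq
        rcases hq with rfl | rfl
        · exact hy
        · exact hx
      · rw [h1', Finset.card_singleton, max_eq_left h]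

theorem exists_isDecreasing_card_eq_iff (t : BinaryTree Unit) {a z e : ℕ} (hz : z < a) (he : e < a)
    (k : ℕ) :
    (∃ D ⊆ treePoints t a z e, IsDecreasing D ∧ D.card = k) ↔ k ≤ height t := by
  constructor
  · rintro ⟨D, h1, h2, rfl⟩
    exact (card_le_of_isDecreasing t hz he h2 h1).1
  · intro hk
    obtain ⟨D, h1, h2, h3⟩ := exists_isDecreasing_card_eq_height t hz he
    obtain ⟨E, hE, hEk⟩ := Finset.exists_subset_card_eq (hk.trans h3.ge)
    exact ⟨E, hE.trans h1, h2.mono hE, hEk⟩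

open List in
/-- The word `u` has no subsequence in the relative order `213`. -/
def Avoids213 (u : List ℕ) : Prop :=
  ∀ x y z : ℕ, [x, y, z] <+ u → y < x → ¬ x < z

/-- The `213`-avoiding arrangement of `a, a + 1, …, a + t.numNodes - 1` encoded by the tree `t`. -/
def treeWord : BinaryTree Unit → ℕ → List ℕ
  | .nil, _ => []
  | .node _ A B, a => treeWord A (a + 1 + B.numNodes) ++ a :: treeWord B (a + 1)

theorem length_treeWord (t : BinaryTree Unit) (a : ℕ) : (treeWord t a).length = t.numNodes := by
  induction t generalizing a with
  | nil => rfl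
  | node u A B ihA ihB => simp [treeWord, ihA, ihB, BinaryTree.numNodes]; omega

theorem mem_treeWord (t : BinaryTree Unit) (a x : ℕ) :
    x ∈ treeWord t a ↔ a ≤ x ∧ x < a + t.numNodes := by
  induction t generalizing a with
  | nil => simp [treeWord]
  | node u A B ihA ihB => simp [treeWord, ihA, ihB, BinaryTree.numNodes]; omega

theorem nodup_treeWord (t : BinaryTree Unit) (a : ℕ) : (treeWord t a).Nodup := by
  induction t generalizing a with
  | nil => simp [treeWord]
  | node u A B ihA ihB =>
    rw [treeWord, List.nodup_append]
    refine ⟨ihA _, List.nodup_cons.2 ⟨?_, ihB _⟩, ?_⟩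
    · rw [mem_treeWord]; omega
    · intro x hx y hy
      rw [mem_treeWord] at hx
      rw [List.mem_cons, mem_treeWord] at hy
      omega

theorem treeWord_injective {t s : BinaryTree Unit} {a : ℕ} (h : treeWord t a = treeWord s a) :
    t = s := by
  induction t generalizing s a with
  | nil =>
    cases s with
    | nil => rfl
    | node => simp [treeWord] at h
  | node u A B ihA ihB =>
    cases s with
    | nil => simp [treeWord] at h
    | node v A' B' =>
      simp only [treeWord] at h
      rw [List.append_cons_inj_of_notMem (by rw [mem_treeWord]; omega)
        (by rw [mem_treeWord]; omega)] at h
      obtain ⟨h1, _, h2⟩ := h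
      obtain rfl := ihB h2
      obtain rfl := ihA h1
      rfl

theorem avoids213_append_cons {s r : List ℕ} {a : ℕ} (hs : Avoids213 s) (hr : Avoids213 r)
    (hsr : ∀ x ∈ s, ∀ y ∈ a :: r, y < x) (har : ∀ y ∈ r, a < y) : Avoids213 (s ++ a :: r) := by
  intro x y z h hyx hxz
  rw [List.sublist_append_iff] at h
  obtain ⟨l₁, l₂, hl, h1, h2⟩ := h
  match l₁, hl with
  | [], hl =>
    simp only [List.nil_append] at hl
    subst hl
    rw [List.sublist_cons_iff] at h2
    rcases h2 with h2 | ⟨l, hl, h2⟩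
    · exact hr x y z h2 hyx hxz
    · simp only [List.cons.injEq] at hl
      obtain ⟨rfl, rfl⟩ := hl
      have := har y (h2.subset (by simp))
      omega
  | [b], hl =>
    simp only [List.cons_append, List.nil_append, List.cons.injEq] at hl
    obtain ⟨rfl, rfl⟩ := hl
    have := hsr x (h1.subset (by simp)) z (h2.subset (by simp))
    omega
  | [b, c], hl =>
    simp only [List.cons_append, List.nil_append, List.cons.injEq] at hl
    obtain ⟨rfl, rfl, rfl⟩ := hl
    have := hsr x (h1.subset (by simp)) z (h2.subset (by simp))
    omega
  | [b, c, d], hl =>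
    simp only [List.cons_append, List.nil_append, List.cons.injEq] at hl
    obtain ⟨rfl, rfl, rfl, _⟩ := hl
    exact hs x y z h1 hyx hxz
  | b :: c :: d :: e :: l, hl => simp at hl

theorem avoids213_treeWord (t : BinaryTree Unit) (a : ℕ) : Avoids213 (treeWord t a) := by
  induction t generalizing a with
  | nil => intro x y z h; simp [treeWord] at h
  | node u A B ihA ihB =>
    refine avoids213_append_cons (ihA _) (ihB _) ?_ ?_
    · intro x hx y hy
      rw [mem_treeWord] at hx
      rw [List.mem_cons, mem_treeWord] at hy
      omega
    · intro y hy
      rw [mem_treeWord] at hy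
      omega

theorem exists_treeWord_eq (u : List ℕ) (a : ℕ) (hn : u.Nodup)
    (hmem : ∀ x, x ∈ u ↔ a ≤ x ∧ x < a + u.length) (hav : Avoids213 u) :
    ∃ t, treeWord t a = u := by
  induction hlen : u.length using Nat.strong_induction_on generalizing u a with
  | _ n ih =>
    by_cases hu : u = []
    · exact ⟨.nil, by simp [treeWord, hu]⟩
    have hpos := List.length_pos_of_ne_nil hu
    obtain ⟨s, r, rfl⟩ := List.append_of_mem ((hmem a).2 ⟨le_rfl, by omega⟩)
    rw [List.nodup_append, List.nodup_cons] at hn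
    obtain ⟨hs, ⟨har, hr⟩, hsr⟩ := hn
    have hlt : ∀ x ∈ s, ∀ y ∈ r, y < x := by
      intro x hx y hy
      by_contra hxy
      have h1 := hsr x hx y (by simp [hy])
      have h2 := hsr x hx a (by simp)
      have h3 := (hmem x).1 (by simp [hx])
      refine hav x a y ?_ (by omega) (by omega)
      exact (List.singleton_sublist.2 hx).append
        (List.cons_sublist_cons.2 (List.singleton_sublist.2 hy))
    simp only [List.length_append, List.length_cons] at hmem hlen
    simp only [List.mem_append, List.mem_cons] at hmem
    have hrsub : ∀ y ∈ r, a + 1 ≤ y ∧ y < a + 1 + r.length := by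
      intro y hy
      have h1 := (hmem y).1 (by simp [hy])
      have h2 : y ≠ a := fun h => har (h ▸ hy)
      refine ⟨by omega, ?_⟩
      have hsub : Finset.Icc (a + 1) y ⊆ r.toFinset := by
        intro x hx
        rw [Finset.mem_Icc] at hx
        rw [List.mem_toFinset]
        rcases (hmem x).2 (by omega) with h | h | h
        · have := hlt x h y hy
          omega
        · omega
        · exact h
      have := Finset.card_le_card hsub
      rw [Nat.card_Icc, List.toFinset_card_of_nodup hr] at this
      omega
    have hreq : r.toFinset = Finset.Ico (a + 1) (a + 1 + r.length) := by
      refine Finset.eq_of_subset_of_card_le (fun y hy => ?_) ?_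
      · rw [Finset.mem_Ico]
        exact hrsub y (List.mem_toFinset.1 hy)
      · rw [Nat.card_Ico, List.toFinset_card_of_nodup hr]
        omega
    have hrmem : ∀ x, x ∈ r ↔ a + 1 ≤ x ∧ x < a + 1 + r.length := fun x => by
      rw [← List.mem_toFinset, hreq, Finset.mem_Ico]
    have hsmem : ∀ x, x ∈ s ↔ a + 1 + r.length ≤ x ∧ x < a + 1 + r.length + s.length := by
      intro x
      constructor
      · intro hx
        have h1 := (hmem x).1 (Or.inl hx)
        have h2 := hsr x hx a (by simp)
        have h3 : x ∉ r := fun h => hsr x hx x (by simp [h]) rfl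
        rw [hrmem] at h3
        omega
      · intro hx
        rcases (hmem x).2 (by omega) with h | h | h
        · exact h
        · omega
        · rw [hrmem] at h
          omega
    obtain ⟨A, hA⟩ := ih s.length (by omega) s (a + 1 + r.length) hs hsmem
      (fun x y z h => hav x y z (h.trans (List.sublist_append_left _ _))) rfl
    obtain ⟨B, hB⟩ := ih r.length (by omega) r (a + 1) hr hrmem
      (fun x y z h => hav x y z
        (h.trans ((List.sublist_cons_self _ _).trans (List.sublist_append_right _ _)))) rfl
    refine ⟨.node () A B, ?_⟩
    rw [treeWord, hB, ← length_treeWord B (a + 1), hB, hA]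

theorem mem_treePoints_iff_mem_zip (t : BinaryTree Unit) (a z e : ℕ) (p : ℕ × ℕ) :
    p ∈ treePoints t a z e ↔ p ∈ (z :: treeWord t a).zip (treeWord t a ++ [e]) := by
  induction t generalizing a z e with
  | nil => simp [treePoints, treeWord]
  | node u A B ihA ihB =>
    have h1 : z :: treeWord (.node u A B) a =
        (z :: treeWord A (a + 1 + B.numNodes)) ++ (a :: treeWord B (a + 1)) := rfl
    have h2 : treeWord (.node u A B) a ++ [e] =
        (treeWord A (a + 1 + B.numNodes) ++ [a]) ++ (treeWord B (a + 1) ++ [e]) := by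
      simp [treeWord]
    rw [h1, h2, List.zip_append (by simp), List.mem_append, ← ihA, ← ihB, treePoints,
      Finset.mem_union]

theorem contains_pattern213_iff {n : ℕ} (w : Fin n → Fin n) :
    Contains w pattern213 ↔ ∃ i j k, i < j ∧ j < k ∧ w j < w i ∧ w i < w k := by
  constructor
  · rintro ⟨f, hf, h⟩
    exact ⟨f 0, f 1, f 2, hf (by decide), hf (by decide), (h 1 0).2 (by decide),
      (h 0 2).2 (by decide)⟩
  · rintro ⟨i, j, k, hij, hjk, h1, h2⟩
    refine ⟨![i, j, k], ?_, ?_⟩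
    · rw [Fin.strictMono_iff_lt_succ]
      intro x
      fin_cases x
      · exact hij
      · exact hjk
    · have e0 : pattern213 0 = 1 := by decide
      have e1 : pattern213 1 = 0 := by decide
      have e2 : pattern213 2 = 2 := by decide
      intro x y
      fin_cases x <;> fin_cases y <;>
        simp [e0, e1, e2, h1, h2, h1.le, h2.le, h1.trans h2, (h1.trans h2).le]

open List in
theorem triple_sublist_ofFn_iff {n : ℕ} (g : Fin n → ℕ) (x y z : ℕ) :
    [x, y, z] <+ List.ofFn g ↔ ∃ i j k, i < j ∧ j < k ∧ g i = x ∧ g j = y ∧ g k = z := by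
  rw [List.sublist_iff_exists_fin_orderEmbedding_get_eq]
  constructor
  · rintro ⟨f, hf⟩
    have hlen : (List.ofFn g).length = n := List.length_ofFn
    refine ⟨Fin.cast hlen (f ⟨0, by simp⟩), Fin.cast hlen (f ⟨1, by simp⟩),
      Fin.cast hlen (f ⟨2, by simp⟩), ?_, ?_, ?_, ?_, ?_⟩
    · exact f.strictMono (show (0 : ℕ) < 1 by omega)
    · exact f.strictMono (show (1 : ℕ) < 2 by omega)
    · have h := (hf ⟨0, by simp⟩).symm
      rw [List.get_ofFn] at h
      exact h
    · have h := (hf ⟨1, by simp⟩).symm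
      rw [List.get_ofFn] at h
      exact h
    · have h := (hf ⟨2, by simp⟩).symm
      rw [List.get_ofFn] at h
      exact h
  · rintro ⟨i, j, k, hij, hjk, rfl, rfl, rfl⟩
    have hlen : n = (List.ofFn g).length := List.length_ofFn.symm
    have hm : StrictMono (![i, j, k]) := by
      rw [Fin.strictMono_iff_lt_succ]
      intro x
      fin_cases x
      · exact hij
      · exact hjk
    refine ⟨OrderEmbedding.ofStrictMono (fun x : Fin 3 => Fin.cast hlen (![i, j, k] x))
      fun a b hab => hm hab, ?_⟩
    intro x
    change Fin 3 at x
    fin_cases x <;> simp <;> rfl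

theorem avoids_pattern213_iff {n : ℕ} (w : Fin n → Fin n) :
    Avoids w pattern213 ↔ Avoids213 (List.ofFn fun i => (w i : ℕ)) := by
  rw [Avoids, contains_pattern213_iff]
  constructor
  · intro h x y z hs hyx hxz
    rw [triple_sublist_ofFn_iff] at hs
    obtain ⟨i, j, k, hij, hjk, rfl, rfl, rfl⟩ := hs
    exact h ⟨i, j, k, hij, hjk, hyx, hxz⟩
  · rintro h ⟨i, j, k, hij, hjk, h1, h2⟩
    exact h _ _ _ ((triple_sublist_ofFn_iff _ _ _ _).2 ⟨i, j, k, hij, hjk, rfl, rfl, rfl⟩) h1 h2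

theorem avoids213_zero_cons_iff {u : List ℕ} : Avoids213 (0 :: u) ↔ Avoids213 u := by
  constructor
  · exact fun h x y z hs => h x y z (hs.trans (List.sublist_cons_self _ _))
  · intro h x y z hs hyx
    rw [List.sublist_cons_iff] at hs
    rcases hs with hs | ⟨l, hl, _⟩
    · exact h x y z hs hyx
    · simp only [List.cons.injEq] at hl
      omega

section Cyclic

variable {m : ℕ} {π : Equiv.Perm (Fin (m + 1))}

theorem cycleForm_apply (π : Equiv.Perm (Fin (m + 1))) (i : Fin (m + 1)) :
    cycleForm π i = (π ^ (i : ℕ)) 0 := rfl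

theorem IsCyclicPerm.cycleForm_surjective (h : IsCyclicPerm π) :
    Function.Surjective (cycleForm π) := by
  intro x
  have h2 : π.IsCycleOn ((Finset.univ : Finset (Fin (m + 1))) : Set (Fin (m + 1))) := by
    simpa using h.2
  obtain ⟨k, hk, hkx⟩ := h2.exists_pow_eq (Finset.mem_univ 0) (Finset.mem_univ x)
  exact ⟨⟨k, by simpa using hk⟩, hkx⟩

theorem IsCyclicPerm.cycleForm_injective (h : IsCyclicPerm π) :
    Function.Injective (cycleForm π) :=
  Finite.injective_iff_surjective.2 h.cycleForm_surjective

theorem apply_cycleForm_castSucc (π : Equiv.Perm (Fin (m + 1))) (i : Fin m) :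
    π (cycleForm π i.castSucc) = cycleForm π i.succ := by
  simp [cycleForm_apply, pow_succ']

theorem IsCyclicPerm.apply_cycleForm_last (h : IsCyclicPerm π) :
    π (cycleForm π (Fin.last m)) = 0 := by
  have h2 : π.IsCycleOn ((Finset.univ : Finset (Fin (m + 1))) : Set (Fin (m + 1))) := by
    simpa using h.2
  have := h2.pow_card_apply (Finset.mem_univ 0)
  rwa [Finset.card_univ, Fintype.card_fin, pow_succ'] at this

theorem isCyclicPerm_of_cycleForm_surjective (h : Function.Surjective (cycleForm π)) :
    IsCyclicPerm π := by
  have hs : ∀ x, π.SameCycle 0 x := fun x => by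
    obtain ⟨i, rfl⟩ := h x
    exact ⟨(i : ℕ), by rw [zpow_natCast, cycleForm_apply]⟩
  exact ⟨Nat.succ_pos m, Set.bijOn_univ.2 π.bijective, fun x _ y _ => (hs x).symm.trans (hs y)⟩

theorem IsCyclicPerm.eq_of_cycleForm_eq {ρ : Equiv.Perm (Fin (m + 1))} (hπ : IsCyclicPerm π)
    (hρ : IsCyclicPerm ρ) (h : cycleForm π = cycleForm ρ) : π = ρ := by
  ext x : 1
  obtain ⟨i, rfl⟩ := hπ.cycleForm_surjective x
  induction i using Fin.lastCases with
  | last => rw [hπ.apply_cycleForm_last, h, hρ.apply_cycleForm_last]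
  | cast i => rw [apply_cycleForm_castSucc, h, apply_cycleForm_castSucc]

/-- The cycle form of `π` is the word `0 :: treeWord t 1`. -/
def IsEncodedBy (π : Equiv.Perm (Fin (m + 1))) (t : BinaryTree Unit) : Prop :=
  (List.ofFn fun i => (cycleForm π i : ℕ)) = 0 :: treeWord t 1

theorem IsEncodedBy.numNodes {t : BinaryTree Unit} (h : IsEncodedBy π t) : t.numNodes = m := by
  have := congrArg List.length h
  simpa [length_treeWord] using this.symm

theorem IsEncodedBy.unique {t s : BinaryTree Unit} (ht : IsEncodedBy π t)
    (hs : IsEncodedBy π s) : t = s := by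
  have := ht.symm.trans hs
  exact treeWord_injective (List.cons.inj this).2

theorem IsEncodedBy.eq {ρ : Equiv.Perm (Fin (m + 1))} {t : BinaryTree Unit}
    (hπ : IsCyclicPerm π) (hρ : IsCyclicPerm ρ) (h : IsEncodedBy π t) (h' : IsEncodedBy ρ t) :
    π = ρ := by
  refine hπ.eq_of_cycleForm_eq hρ (funext fun i => Fin.ext ?_)
  exact congrFun (List.ofFn_injective (h.trans h'.symm)) i

theorem IsEncodedBy.avoids {t : BinaryTree Unit} (h : IsEncodedBy π t) :
    Avoids (cycleForm π) pattern213 := by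
  rw [avoids_pattern213_iff, h, avoids213_zero_cons_iff]
  exact avoids213_treeWord t 1

theorem IsCyclicPerm.exists_isEncodedBy (h : IsCyclicPerm π)
    (hav : Avoids (cycleForm π) pattern213) : ∃ t, IsEncodedBy π t := by
  have hcons : (List.ofFn fun i => (cycleForm π i : ℕ)) =
      0 :: List.ofFn fun i : Fin m => (cycleForm π i.succ : ℕ) := by
    rw [List.ofFn_succ]
    rfl
  have hinj : Function.Injective fun i => (cycleForm π i : ℕ) :=
    Fin.val_injective.comp h.cycleForm_injective
  rw [avoids_pattern213_iff, hcons, avoids213_zero_cons_iff] at hav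
  have hmem : ∀ x, x ∈ (List.ofFn fun i : Fin m => (cycleForm π i.succ : ℕ)) ↔
      1 ≤ x ∧ x < 1 + (List.ofFn fun i : Fin m => (cycleForm π i.succ : ℕ)).length := by
    intro x
    rw [List.mem_ofFn, List.length_ofFn]
    constructor
    · rintro ⟨i, rfl⟩
      have h0 : (cycleForm π i.succ : ℕ) ≠ cycleForm π 0 := fun h =>
        Fin.succ_ne_zero i (hinj h)
      have h1 : (cycleForm π 0 : ℕ) = 0 := rfl
      omega
    · rintro ⟨h1, h2⟩
      obtain ⟨i, hi⟩ := h.cycleForm_surjective ⟨x, by omega⟩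
      have hi0 : i ≠ 0 := by
        rintro rfl
        have : (0 : ℕ) = x := congrArg Fin.val hi
        omega
      obtain ⟨j, rfl⟩ := Fin.exists_succ_eq_of_ne_zero hi0
      exact ⟨j, congrArg Fin.val hi⟩
  obtain ⟨t, ht⟩ := exists_treeWord_eq _ 1
    (List.nodup_ofFn.2 (hinj.comp (Fin.succ_injective m))) hmem hav
  exact ⟨t, by rw [IsEncodedBy, hcons, ht]; rfl⟩

theorem exists_perm_isEncodedBy {t : BinaryTree Unit} (ht : t.numNodes = m) :
    ∃ π : Equiv.Perm (Fin (m + 1)), IsCyclicPerm π ∧ IsEncodedBy π t := by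
  have hlen : (0 :: treeWord t 1).length = m + 1 := by simp [length_treeWord, ht]
  have hnodup : (0 :: treeWord t 1).Nodup := by
    rw [List.nodup_cons, mem_treeWord]
    exact ⟨by omega, nodup_treeWord t 1⟩
  have hlt : ∀ x ∈ 0 :: treeWord t 1, x < m + 1 := by
    intro x hx
    rw [List.mem_cons, mem_treeWord] at hx
    omega
  let c : Fin (m + 1) → Fin (m + 1) := fun i =>
    ⟨(0 :: treeWord t 1)[(i : ℕ)]'(by rw [hlen]; exact i.2), hlt _ (List.getElem_mem _)⟩
  have hc : Function.Injective c := by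
    intro i j hij
    exact Fin.ext ((hnodup.getElem_inj_iff).1 (congrArg Fin.val hij))
  let e : Equiv.Perm (Fin (m + 1)) :=
    Equiv.ofBijective c (Finite.injective_iff_bijective.1 hc)
  let π : Equiv.Perm (Fin (m + 1)) := e * finRotate (m + 1) * e⁻¹
  have hpow : ∀ (k : ℕ) (hk : k < m + 1), (π ^ k) 0 = e ⟨k, hk⟩ := by
    intro k
    induction k with
    | zero => intro hk; rfl
    | succ k ih =>
      intro hk
      rw [pow_succ', Equiv.Perm.mul_apply, ih (by omega)]
      change e (finRotate (m + 1) (e.symm (e ⟨k, _⟩))) = _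
      rw [Equiv.symm_apply_apply, finRotate_of_lt (by omega)]
  have hform : cycleForm π = e := funext fun i => hpow i i.2
  refine ⟨π, isCyclicPerm_of_cycleForm_surjective (by rw [hform]; exact e.surjective), ?_⟩
  rw [IsEncodedBy, hform]
  refine List.ext_getElem (by rw [hlen, List.length_ofFn]) fun i h1 h2 => ?_
  rw [List.getElem_ofFn]
  rfl

theorem mem_zip_ofFn_iff {n : ℕ} (f g : Fin n → ℕ) (p : ℕ × ℕ) :
    p ∈ (List.ofFn f).zip (List.ofFn g) ↔ ∃ i, p = (f i, g i) := by
  rw [List.mem_iff_getElem]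
  constructor
  · rintro ⟨i, hi, rfl⟩
    exact ⟨⟨i, by simpa using hi⟩, by simp⟩
  · rintro ⟨i, rfl⟩
    exact ⟨i, by simp, by simp⟩

theorem IsEncodedBy.mem_treePoints_iff {t : BinaryTree Unit} (hπ : IsCyclicPerm π)
    (h : IsEncodedBy π t) (p : ℕ × ℕ) :
    p ∈ treePoints t 1 0 0 ↔ ∃ x : Fin (m + 1), p = ((x : ℕ), (π x : ℕ)) := by
  have htail : treeWord t 1 = List.ofFn fun i : Fin m => (cycleForm π i.succ : ℕ) := by
    rw [IsEncodedBy, List.ofFn_succ] at h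
    exact (List.cons.inj h).2.symm
  have hrot : treeWord t 1 ++ [0] = List.ofFn fun i => (π (cycleForm π i) : ℕ) := by
    rw [List.ofFn_succ', hπ.apply_cycleForm_last, htail, List.concat_eq_append]
    simp only [apply_cycleForm_castSucc]
    rfl
  rw [mem_treePoints_iff_mem_zip, ← h, hrot, mem_zip_ofFn_iff,
    ← hπ.cycleForm_surjective.exists (p := fun x => p = ((x : ℕ), (π x : ℕ)))]

end Cyclic

theorem contains_decreasing_iff {n : ℕ} (w : Fin n → Fin n) (k : ℕ) (P : Finset (ℕ × ℕ))
    (hP : ∀ p, p ∈ P ↔ ∃ x : Fin n, p = ((x : ℕ), (w x : ℕ))) :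
    Contains w (decreasing k) ↔ ∃ D ⊆ P, IsDecreasing D ∧ D.card = k := by
  simp only [Contains, decreasing, Fin.revPerm_apply, Fin.rev_lt_rev]
  constructor
  · rintro ⟨f, hf, h⟩
    refine ⟨Finset.univ.image fun i => ((f i : ℕ), (w (f i) : ℕ)), ?_, ?_, ?_⟩
    · intro p hp
      obtain ⟨i, _, rfl⟩ := Finset.mem_image.1 hp
      exact (hP _).2 ⟨f i, rfl⟩
    · intro p hp q hq hne
      obtain ⟨i, _, rfl⟩ := Finset.mem_image.1 hp
      obtain ⟨j, _, rfl⟩ := Finset.mem_image.1 hq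
      rcases lt_trichotomy i j with hij | rfl | hij
      · exact Or.inl ⟨hf hij, (h j i).2 hij⟩
      · exact absurd rfl hne
      · exact Or.inr ⟨hf hij, (h i j).2 hij⟩
    · rw [Finset.card_image_of_injective _ fun i j hij =>
        hf.injective (Fin.ext (congrArg Prod.fst hij)), Finset.card_univ, Fintype.card_fin]
  · rintro ⟨D, hDP, hD, rfl⟩
    have hinj : Set.InjOn Prod.fst (D : Set (ℕ × ℕ)) := by
      intro p hp q hq hpq
      by_contra hne
      have := hD p hp q hq hne
      omega
    have hcard : (D.image Prod.fst).card = D.card := Finset.card_image_of_injOn hinj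
    have hx : ∀ i : Fin D.card, ∃ x : Fin n,
        (x : ℕ) = (D.image Prod.fst).orderEmbOfFin hcard i ∧ ((x : ℕ), (w x : ℕ)) ∈ D := by
      intro i
      obtain ⟨p, hp, hpi⟩ := Finset.mem_image.1 ((D.image Prod.fst).orderEmbOfFin_mem hcard i)
      obtain ⟨x, rfl⟩ := (hP p).1 (hDP hp)
      exact ⟨x, hpi, hp⟩
    choose f hf hfD using hx
    have hmono : StrictMono f := fun i j hij => by
      rw [Fin.lt_def, hf, hf]
      exact ((D.image Prod.fst).orderEmbOfFin hcard).strictMono hij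
    have hanti : ∀ i j, i < j → w (f j) < w (f i) := fun i j hij => by
      have hlt : (f i : ℕ) < f j := hmono hij
      have := hD _ (hfD i) _ (hfD j) fun h => hlt.ne (congrArg Prod.fst h)
      simp only at this
      rw [Fin.lt_def]
      omega
    refine ⟨f, hmono, fun i j => ⟨fun h => ?_, hanti j i⟩⟩
    by_contra hij
    rcases (not_lt.1 hij).eq_or_lt with rfl | hij
    · exact lt_irrefl _ h
    · exact lt_asymm h (hanti i j hij)

theorem IsEncodedBy.avoids_decreasing_iff {m : ℕ} {π : Equiv.Perm (Fin (m + 1))}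
    {t : BinaryTree Unit} (hπ : IsCyclicPerm π) (h : IsEncodedBy π t) (k : ℕ) :
    Avoids (fun i => π i) (decreasing k) ↔ height t < k := by
  rw [Avoids, contains_decreasing_iff _ k (treePoints t 1 0 0) (h.mem_treePoints_iff hπ),
    exists_isDecreasing_card_eq_iff t one_pos one_pos, not_le]

theorem a_succ_eq_card (m k : ℕ) :
    a (m + 1) k pattern213 =
      ((BinaryTree.treesOfNumNodesEq m).filter (height · < k)).card := by
  rw [a, ← Set.ncard_coe_finset]
  refine Set.ncard_congr (fun π h => (h.1.exists_isEncodedBy h.2.2).choose) ?_ ?_ ?_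
  · intro π h
    have ht := (h.1.exists_isEncodedBy h.2.2).choose_spec
    rw [Finset.mem_coe, Finset.mem_filter, BinaryTree.mem_treesOfNumNodesEq]
    exact ⟨ht.numNodes, (ht.avoids_decreasing_iff h.1 k).1 h.2.1⟩
  · intro π ρ h h' heq
    have ht := (h.1.exists_isEncodedBy h.2.2).choose_spec
    have ht' := (h'.1.exists_isEncodedBy h'.2.2).choose_spec
    rw [← heq] at ht'
    exact ht.eq h.1 h'.1 ht'
  · intro t ht
    rw [Finset.mem_coe, Finset.mem_filter, BinaryTree.mem_treesOfNumNodesEq] at ht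
    obtain ⟨π, hπ, hπt⟩ := exists_perm_isEncodedBy ht.1
    have hmem : π ∈ avoidanceClass (m + 1) (decreasing k) pattern213 :=
      ⟨hπ, (hπt.avoids_decreasing_iff hπ k).2 ht.2, hπt.avoids⟩
    exact ⟨π, hmem, (hmem.1.exists_isEncodedBy hmem.2.2).choose_spec.unique hπt⟩

open PowerSeries

/-- The number of binary trees with `m` nodes and `lowHeight` at most `h`. -/
def treeCount (m h : ℕ) : ℕ :=
  ((BinaryTree.treesOfNumNodesEq m).filter (lowHeight · ≤ h)).card

theorem treeCount_zero_left (h : ℕ) : treeCount 0 h = 1 := by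
  simp [treeCount, lowHeight, Finset.filter_singleton]

theorem ne_nil_of_numNodes_ne_zero {t : BinaryTree Unit} (h : t.numNodes ≠ 0) : t ≠ .nil := by
  rintro rfl
  exact h rfl

theorem treeCount_succ_zero (m : ℕ) : treeCount (m + 1) 0 = 0 := by
  rw [treeCount, Finset.card_eq_zero, Finset.filter_eq_empty_iff]
  intro t ht
  rw [BinaryTree.mem_treesOfNumNodesEq] at ht
  have := lowHeight_pos (ne_nil_of_numNodes_ne_zero (t := t) (by omega))
  omega

/-- The trees with `m + 1` nodes and `lowHeight` at most `h`, sorted by the sizes of the two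
subtrees of the root. -/
theorem treeCount_succ (m h : ℕ) :
    treeCount (m + 1) h = ∑ ij ∈ Finset.HasAntidiagonal.antidiagonal m,
      (((BinaryTree.treesOfNumNodesEq ij.1) ×ˢ (BinaryTree.treesOfNumNodesEq ij.2)).filter
        fun AB => lowHeight (.node () AB.1 AB.2) ≤ h).card := by
  rw [treeCount, BinaryTree.treesOfNumNodesEq_succ, Finset.filter_biUnion, Finset.card_biUnion]
  · refine Finset.sum_congr rfl fun ij _ => ?_
    rw [Finset.filter_map, Finset.card_map]
    rfl
  · rintro ⟨i, j⟩ _ ⟨i', j'⟩ _ hne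
    rw [Function.onFun, Finset.disjoint_left]
    intro t ht ht'
    simp only [Finset.mem_filter, Finset.mem_map, Finset.mem_product,
      BinaryTree.mem_treesOfNumNodesEq] at ht ht'
    obtain ⟨⟨⟨A, B⟩, ⟨h1, h2⟩, rfl⟩, _⟩ := ht
    obtain ⟨⟨⟨A', B'⟩, ⟨h1', h2'⟩, h3'⟩, _⟩ := ht'
    obtain ⟨_, hA, hB⟩ := BinaryTree.node.inj h3'
    subst hA hB
    exact hne (by rw [← h1, ← h2, ← h1', ← h2'])

theorem card_filter_left_nil (j h : ℕ) (hh : 1 ≤ h) :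
    (((BinaryTree.treesOfNumNodesEq 0) ×ˢ (BinaryTree.treesOfNumNodesEq j)).filter
        fun AB => lowHeight (.node () AB.1 AB.2) ≤ h).card = treeCount j h := by
  rw [BinaryTree.treesOfNumNodesEq_zero, Finset.singleton_product, Finset.filter_map,
    Finset.card_map, treeCount]
  congr 1
  refine Finset.filter_congr fun t _ => ?_
  simp [lowHeight_node_nil, hh]

theorem card_filter_left_ne_nil (i j h : ℕ) :
    (((BinaryTree.treesOfNumNodesEq (i + 1)) ×ˢ (BinaryTree.treesOfNumNodesEq j)).filter
        fun AB => lowHeight (.node () AB.1 AB.2) ≤ h + 2).card =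
      treeCount (i + 1) (h + 2) * treeCount j h := by
  rw [treeCount, treeCount, ← Finset.card_product, ← Finset.filter_product]
  congr 1
  refine Finset.filter_congr fun t ht => ?_
  rw [Finset.mem_product, BinaryTree.mem_treesOfNumNodesEq] at ht
  rw [lowHeight_node (ne_nil_of_numNodes_ne_zero (by omega))]
  omega

theorem card_filter_left_ne_nil_one (i j : ℕ) :
    (((BinaryTree.treesOfNumNodesEq (i + 1)) ×ˢ (BinaryTree.treesOfNumNodesEq j)).filter
        fun AB => lowHeight (.node () AB.1 AB.2) ≤ 1).card = 0 := by
  rw [Finset.card_eq_zero, Finset.filter_eq_empty_iff]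
  intro t ht
  rw [Finset.mem_product, BinaryTree.mem_treesOfNumNodesEq] at ht
  rw [lowHeight_node (ne_nil_of_numNodes_ne_zero (by omega))]
  omega

theorem treeCount_one (m : ℕ) : treeCount m 1 = 1 := by
  induction m with
  | zero => exact treeCount_zero_left 1
  | succ m ih =>
    rw [treeCount_succ, Finset.Nat.sum_antidiagonal_eq_sum_range_succ_mk,
      Finset.sum_range_succ', Finset.sum_eq_zero fun i _ => card_filter_left_ne_nil_one i _]
    rw [card_filter_left_nil _ _ le_rfl]
    simpa using ih

/-- The generating function of `treeCount · h`. -/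
noncomputable def treeSeries (h : ℕ) : PowerSeries ℤ :=
  PowerSeries.mk fun m => (treeCount m h : ℤ)

theorem treeSeries_zero : treeSeries 0 = 1 := by
  ext m
  cases m with
  | zero => simp [treeSeries, treeCount_zero_left]
  | succ m => simp [treeSeries, treeCount_succ_zero, PowerSeries.coeff_one]

theorem treeSeries_one : treeSeries 1 = 1 + X * treeSeries 1 := by
  ext m
  cases m with
  | zero => simp [treeSeries, treeCount_zero_left]
  | succ m =>
    rw [map_add, PowerSeries.coeff_succ_X_mul]
    simp [treeSeries, treeCount_one, PowerSeries.coeff_one]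

theorem treeSeries_add_two (h : ℕ) :
    treeSeries (h + 2) =
      1 + X * (treeSeries (h + 2) + (treeSeries (h + 2) - 1) * treeSeries h) := by
  ext m
  cases m with
  | zero => simp [treeSeries, treeCount_zero_left]
  | succ m =>
    rw [map_add, PowerSeries.coeff_succ_X_mul, map_add, PowerSeries.coeff_mul]
    simp only [treeSeries, PowerSeries.coeff_mk, map_sub]
    rw [treeCount_succ, Finset.Nat.sum_antidiagonal_eq_sum_range_succ_mk,
      Finset.Nat.sum_antidiagonal_eq_sum_range_succ_mk,
      Finset.sum_range_succ', Finset.sum_range_succ']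
    simp only [card_filter_left_ne_nil]
    rw [card_filter_left_nil _ _ (by omega)]
    simp [PowerSeries.coeff_one, treeCount_zero_left]
    ring

theorem treeSeries_succ (h : ℕ) :
    treeSeries (h + 1) = 1 + X * (treeSeries (h + 1) * treeSeries h) := by
  induction h with
  | zero => simpa [treeSeries_zero] using treeSeries_one
  | succ h ih =>
    have key := treeSeries_add_two h
    linear_combination treeSeries (h + 1) * key + (1 - treeSeries (h + 2)) * ih

theorem treeCount_succ_succ (m h : ℕ) :
    treeCount (m + 1) (h + 1) =
      ∑ ij ∈ Finset.HasAntidiagonal.antidiagonal m, treeCount ij.1 (h + 1) * treeCount ij.2 h := by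
  have key := congrArg (PowerSeries.coeff (m + 1)) (treeSeries_succ h)
  rw [map_add, PowerSeries.coeff_succ_X_mul, PowerSeries.coeff_mul] at key
  simp only [treeSeries, PowerSeries.coeff_mk, PowerSeries.coeff_one] at key
  simp only [Nat.add_eq_zero_iff, one_ne_zero, and_false, if_false, zero_add] at key
  exact_mod_cast key

theorem treeCount_two (m : ℕ) : treeCount (m + 1) 2 = 2 ^ m := by
  have h : ∀ m, treeCount (m + 1) 2 = ∑ i ∈ Finset.range (m + 1), treeCount i 2 := fun m => by
    rw [treeCount_succ_succ, Finset.Nat.sum_antidiagonal_eq_sum_range_succ_mk]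
    simp [treeCount_one]
  induction m with
  | zero => simp [h, treeCount_zero_left]
  | succ m ih => rw [h, Finset.sum_range_succ, ← h, ih]; ring

theorem a_succ_eq_treeCount (m : ℕ) {k : ℕ} (hk : 3 ≤ k) :
    a (m + 1) k pattern213 = treeCount m (k - 1) := by
  rw [a_succ_eq_card, treeCount]
  congr 1
  refine Finset.filter_congr fun t _ => ?_
  rw [← height_le_iff_lowHeight_le (by omega)]
  omega

theorem a_recurrence {n k : ℕ} (hn : 2 ≤ n) (hk : 4 ≤ k) :
    a n k pattern213 =
      ∑ i ∈ Finset.Icc 1 (n - 1), a i k pattern213 * a (n - i) (k - 1) pattern213 := by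
  obtain ⟨m, rfl⟩ : ∃ m, n = m + 2 := ⟨n - 2, by omega⟩
  obtain ⟨h, rfl⟩ : ∃ h, k = h + 2 := ⟨k - 2, by omega⟩
  rw [a_succ_eq_treeCount _ (by omega), show h + 2 - 1 = h + 1 by omega, treeCount_succ_succ,
    Finset.Nat.sum_antidiagonal_eq_sum_range_succ_mk, Nat.succ_eq_add_one]
  have hIcc : Finset.Icc 1 (m + 2 - 1) = Finset.Ico 1 (m + 2) := by
    ext i
    simp only [Finset.mem_Icc, Finset.mem_Ico]
    omega
  rw [hIcc, Finset.sum_Ico_eq_sum_range]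
  refine Finset.sum_congr rfl fun i hi => ?_
  rw [Finset.mem_range] at hi
  rw [show m + 2 - (1 + i) = m - i + 1 by omega, add_comm 1 i,
    a_succ_eq_treeCount _ (by omega), a_succ_eq_treeCount _ (by omega)]
  rfl

theorem a_one {k : ℕ} (hk : 2 ≤ k) : a 1 k pattern213 = 1 := by
  rw [a_succ_eq_card, BinaryTree.treesOfNumNodesEq_zero, Finset.filter_singleton,
    if_pos (by rw [height]; omega), Finset.card_singleton]

theorem a_one_one : a 1 1 pattern213 = 0 := by
  rw [a_succ_eq_card, BinaryTree.treesOfNumNodesEq_zero, Finset.filter_singleton,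
    if_neg (by rw [height]; omega), Finset.card_empty]

theorem a_eq_zero {n k : ℕ} (hn : 2 ≤ n) (hk : k ≤ 2) : a n k pattern213 = 0 := by
  obtain ⟨m, rfl⟩ : ∃ m, n = m + 1 := ⟨n - 1, by omega⟩
  rw [a_succ_eq_card, Finset.card_eq_zero, Finset.filter_eq_empty_iff]
  intro t ht
  rw [BinaryTree.mem_treesOfNumNodesEq] at ht
  rw [height_of_ne_nil (ne_nil_of_numNodes_ne_zero (by omega))]
  omega

theorem a_three {n : ℕ} (hn : 2 ≤ n) : a n 3 pattern213 = 2 ^ (n - 2) := by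
  obtain ⟨m, rfl⟩ : ∃ m, n = m + 2 := ⟨n - 2, by omega⟩
  rw [a_succ_eq_treeCount _ le_rfl]
  exact treeCount_two m

end CyclePattern

theorem theorem2p1 :
    (∀ n k : ℕ, 2 ≤ n → 4 ≤ k →
      CyclePattern.a n k CyclePattern.pattern213 =
        ∑ i ∈ Finset.Icc 1 (n - 1),
          CyclePattern.a i k CyclePattern.pattern213 *
            CyclePattern.a (n - i) (k - 1) CyclePattern.pattern213) ∧
    CyclePattern.a 1 1 CyclePattern.pattern213 = 0 ∧
    (∀ k : ℕ, 2 ≤ k → CyclePattern.a 1 k CyclePattern.pattern213 = 1) ∧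
    (∀ n : ℕ, 2 ≤ n → CyclePattern.a n 1 CyclePattern.pattern213 = 0) ∧
    (∀ n : ℕ, 2 ≤ n → CyclePattern.a n 2 CyclePattern.pattern213 = 0) ∧
    (∀ n : ℕ, 2 ≤ n → CyclePattern.a n 3 CyclePattern.pattern213 = 2 ^ (n - 2)) :=
  ⟨fun _ _ => CyclePattern.a_recurrence, CyclePattern.a_one_one, fun _ => CyclePattern.a_one,
    fun _ hn => CyclePattern.a_eq_zero hn one_le_two, fun _ hn => CyclePattern.a_eq_zero hn le_rfl,
    fun _ => CyclePattern.a_three⟩
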